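/- Let $p$ be an odd prime, let $\mathbb{Z}_p$ denote the ring of rational numbers whose denominator is not divisible by $p$, and let $c\in\mathbb{Z}_p$ satisfy $c(c^2+1)\not\equiv 0 \pmod p$. Then $$\left(\sum_{k=0}^{\lfloor p/4\rfloor}\binom{4k}{2k}\left(\frac{c^2}{16(c^2+1)}\right)^k\right)\left(\sum_{k=0}^{\lfloor p/4\rfloor}\binom{4k}{2k}\frac{1}{(16(c^2+1))^k}\right)\equiv\left(\frac{2(c^2+1)}{p}\right)\pmod p,$$ where the congruence is in $\mathbb{Z}_p$ (the difference of the two sides lies in $p\,\mathbb{Z}_p$) and $\left(\frac{\cdot}{p}\right)$ is the Legendre symbol, extended to $\mathbb{Z}_p$ by reduction modulo $p$. -/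

import Mathlib

/-- The ring `ℤ_p` of rational numbers whose denominator (in lowest terms) is not divisible
by `p`, as a set of rationals. -/
def RatPIntegers (p : ℕ) : Set ℚ := {x | ¬ p ∣ x.den}

/-- The congruence `x ≡ y (mod p)` in the ring `ℤ_p` of rationals with denominator prime to `p`:
the difference `x - y` is `p` times an element of `ℤ_p`. -/
def RatCongr (p : ℕ) (x y : ℚ) : Prop := ∃ t ∈ RatPIntegers p, x - y = (p : ℚ) * t

/-- The Legendre symbol `(x / p)` of a rational `x` whose denominator is prime to `p`:
the quadratic character of the residue class of `x` modulo `p`. -/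
noncomputable def ratLegendreSym (p : ℕ) [Fact p.Prime] (x : ℚ) : ℤ :=
  quadraticChar (ZMod p) ((x.num : ZMod p) * (x.den : ZMod p)⁻¹)

section BinomialSums

/-! Write `p = 2n + 1`. Modulo `p`, `(4k).choose (2k)` is `16^k * n.choose (2k)`, so each sum is the
even part of a binomial expansion, `((1 + y)^n + (1 - y)^n) / 2`, with `y = c / s` or `y = 1 / s`,
where `s^2 = c^2 + 1` in an algebraic closure. In the product, `2(s ± c)(s ± 1)` are perfect squares
for all four sign choices, so their `n`-th powers are `(p-1)`-th powers, which Frobenius evaluates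
(`four_pow_sum_eq`). Clearing `s` leaves `(2(c^2 + 1))^n * A * B = 1` for the two sums `A`, `B`, and
Euler's criterion identifies the power with the Legendre symbol. `HasResidue` carries the result
back to rationals. -/

theorem sum_range_two_mul_eq {M : Type*} [AddCommMonoid M] (f : ℕ → M) (N : ℕ) :
    ∑ i ∈ Finset.range (2 * N), f i =
      ∑ k ∈ Finset.range N, (f (2 * k) + f (2 * k + 1)) := by
  induction N with
  | zero => simp
  | succ N ih =>
    rw [show 2 * (N + 1) = 2 * N + 1 + 1 by ring, Finset.sum_range_succ, Finset.sum_range_succ,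
      Finset.sum_range_succ, ih, add_assoc]

theorem one_add_pow_add_one_sub_pow {R : Type*} [CommRing R] (y : R) (n : ℕ) :
    (1 + y) ^ n + (1 - y) ^ n =
      2 * ∑ k ∈ Finset.range (n / 2 + 1), (n.choose (2 * k) : R) * (y ^ 2) ^ k := by
  have expand (z : R) : (1 + z) ^ n =
      ∑ m ∈ Finset.range (2 * (n / 2 + 1)), z ^ m * (n.choose m : R) := by
    rw [add_comm, add_pow]
    simp only [one_pow, mul_one]
    refine Finset.sum_subset (Finset.range_subset_range.2 (by omega)) fun m _ hm => ?_
    have hlt : n < m := by rw [Finset.mem_range] at hm; omega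
    rw [Nat.choose_eq_zero_of_lt hlt, Nat.cast_zero, mul_zero]
  rw [sub_eq_add_neg, expand, expand, ← Finset.sum_add_distrib, sum_range_two_mul_eq,
    Finset.mul_sum]
  refine Finset.sum_congr rfl fun k _ => ?_
  rw [(even_two_mul k).neg_pow, (odd_two_mul_add_one k).neg_pow, ← pow_mul]
  ring

/-- Modulo `p = 2 n + 1`, the central binomial coefficient is `(-4) ^ m * (n choose m)`. -/
theorem centralBinom_cast_eq {K : Type*} [Field K] (p : ℕ) [CharP K p] {n : ℕ}
    (hn : 2 * n + 1 = p) {m : ℕ} (hm : m ≤ n) :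
    (m.centralBinom : K) = (-4) ^ m * (n.choose m : K) := by
  induction m with
  | zero => simp
  | succ m ih =>
    have h1 : ((m + 1 : ℕ) : K) ≠ 0 := by
      rw [Ne, CharP.cast_eq_zero_iff K p]
      exact Nat.not_dvd_of_pos_of_lt (by omega) (by omega)
    have h2 : ((2 * n + 1 : ℕ) : K) = 0 := by rw [hn, CharP.cast_eq_zero]
    have h3 := congrArg (Nat.cast : ℕ → K) (Nat.succ_mul_centralBinom_succ m)
    have h4 := congrArg (Nat.cast : ℕ → K) (Nat.choose_succ_right_eq n m)
    have ih := ih (by omega)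
    push_cast [Nat.cast_sub (show m ≤ n by omega)] at h1 h2 h3 h4
    apply mul_left_cancel₀ h1
    rw [h3, ih, pow_succ]
    -- The ratios of consecutive terms, `2(2m + 1)` and `-4(n - m)` over `m + 1`, agree because `2n
    -- + 1 = 0`.
    linear_combination (4 * (-4) ^ m) * h4 + 2 * (-4) ^ m * (n.choose m : K) * h2

theorem sum_choose_four_mul_eq {K : Type*} [Field K] (p : ℕ) [CharP K p] {n : ℕ}
    (hn : 2 * n + 1 = p) (h16 : (16 : K) ≠ 0) (y : K) :
    2 * ∑ k ∈ Finset.range (p / 4 + 1), ((4 * k).choose (2 * k) : K) * (y ^ 2 / 16) ^ k =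
      (1 + y) ^ n + (1 - y) ^ n := by
  rw [one_add_pow_add_one_sub_pow, show n / 2 = p / 4 by omega]
  congr 1
  refine Finset.sum_congr rfl fun k hk => ?_
  rw [Finset.mem_range] at hk
  have h := centralBinom_cast_eq (K := K) p hn (m := 2 * k) (by omega)
  rw [Nat.centralBinom_eq_two_mul_choose, ← mul_assoc, show 2 * 2 = 4 from rfl, pow_mul] at h
  rw [h, div_pow, show ((-4 : K)) ^ 2 = 16 by norm_num]
  field_simp

end BinomialSums

section CharP

variable {K : Type*} [Field K] (p : ℕ) [Fact p.Prime] [CharP K p]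

/-- The left side is the sum of `(s ± (c ± 1))^(p-1)` over all signs. Since `s^p = ±s`, either every
term is 1, or the terms pair into rational functions of `c` that add up to 4. -/
theorem four_pow_sum_eq {n : ℕ} (hn : 2 * n + 1 = p) {c s : K}
    (hs : s ^ 2 = c ^ 2 + 1) (hcp : c ^ p = c) (hc : c ≠ 0) :
    2 ^ n * (((s + c) ^ n + (s - c) ^ n) * ((s + 1) ^ n + (s - 1) ^ n)) = 4 := by
  have hodd : Odd p := ⟨n, hn.symm⟩
  have hsp : s ^ p = s ∨ s ^ p = -s := by
    rw [← sq_eq_sq_iff_eq_or_eq_neg, ← pow_mul, mul_comm, pow_mul, hs, add_pow_char, one_pow,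
      ← pow_mul, mul_comm 2 p, pow_mul, hcp]
  have e1 : 2 * ((s + c) * (s + 1)) = (s + (c + 1)) ^ 2 := by linear_combination hs
  have e2 : 2 * ((s - c) * (s - 1)) = (s - (c + 1)) ^ 2 := by linear_combination hs
  have e3 : 2 * ((s + c) * (s - 1)) = (s + (c - 1)) ^ 2 := by linear_combination hs
  have e4 : 2 * ((s - c) * (s + 1)) = (s - (c - 1)) ^ 2 := by linear_combination hs
  have hsum : 2 ^ n * (((s + c) ^ n + (s - c) ^ n) * ((s + 1) ^ n + (s - 1) ^ n)) =
      (s + (c + 1)) ^ (2 * n) + (s - (c + 1)) ^ (2 * n) + (s + (c - 1)) ^ (2 * n) +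
        (s - (c - 1)) ^ (2 * n) := by
    simp only [pow_mul, ← e1, ← e2, ← e3, ← e4, mul_pow]
    ring
  have h2 : (2 : K) ≠ 0 := by
    intro h
    have : p ∣ 2 := by rw [← CharP.cast_eq_zero_iff K p]; exact_mod_cast h
    have := Nat.le_of_dvd two_pos this
    have := (Fact.out : p.Prime).two_le
    omega
  -- Dividing by the four bases is legitimate exactly because `c ≠ 0`.
  have n1 : (s + (c + 1)) * (s - (c + 1)) ≠ 0 := by
    rw [show (s + (c + 1)) * (s - (c + 1)) = -(2 * c) by linear_combination hs]
    exact neg_ne_zero.2 (mul_ne_zero h2 hc)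
  have n2 : (s + (c - 1)) * (s - (c - 1)) ≠ 0 := by
    rw [show (s + (c - 1)) * (s - (c - 1)) = 2 * c by linear_combination hs]
    exact mul_ne_zero h2 hc
  have q1 : (c + 1) ^ p = c + 1 := by rw [add_pow_char, hcp, one_pow]
  have q2 : (c - 1) ^ p = c - 1 := by rw [sub_pow_char, hcp, one_pow]
  have pow_add (a : K) (ha : a ^ p = a) (h : s + a ≠ 0) :
      (s + a) ^ (2 * n) = (s ^ p + a) / (s + a) := by
    rw [eq_div_iff h, ← pow_succ, hn, add_pow_char, ha]
  have pow_sub (a : K) (ha : a ^ p = a) (h : s - a ≠ 0) :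
      (s - a) ^ (2 * n) = (s ^ p - a) / (s - a) := by
    rw [eq_div_iff h, ← pow_succ, hn, sub_pow_char, ha]
  have l1 := left_ne_zero_of_mul n1
  have r1 := right_ne_zero_of_mul n1
  have l2 := left_ne_zero_of_mul n2
  have r2 := right_ne_zero_of_mul n2
  rw [hsum, pow_add _ q1 l1, pow_sub _ q1 r1, pow_add _ q2 l2, pow_sub _ q2 r2]
  rcases hsp with h | h
  · rw [h, div_self l1, div_self r1, div_self l2, div_self r2]
    norm_num
  · have f1 : (-s + (c + 1)) / (s + (c + 1)) + (-s - (c + 1)) / (s - (c + 1)) =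
        2 * (c ^ 2 + c + 1) / c := by
      rw [div_add_div _ _ l1 r1, div_eq_div_iff n1 hc]
      linear_combination (-2 * (c ^ 2 + c + 1) - 2 * c) * hs
    have f2 : (-s + (c - 1)) / (s + (c - 1)) + (-s - (c - 1)) / (s - (c - 1)) =
        -(2 * (c ^ 2 - c + 1)) / c := by
      rw [div_add_div _ _ l2 r2, div_eq_div_iff n2 hc]
      linear_combination (2 * (c ^ 2 - c + 1) - 2 * c) * hs
    rw [h, f1, add_assoc, f2]
    field_simp
    ring

end CharP

section PrimeField

variable {p : ℕ} [Fact p.Prime]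

theorem zmod_sum_mul_sum_eq (hp : Odd p) {c : ZMod p} (hc : c ≠ 0) (hd : c ^ 2 + 1 ≠ 0) :
    (∑ k ∈ Finset.range (p / 4 + 1),
        ((4 * k).choose (2 * k) : ZMod p) * (c ^ 2 * (16 * (c ^ 2 + 1))⁻¹) ^ k) *
      (∑ k ∈ Finset.range (p / 4 + 1),
        ((4 * k).choose (2 * k) : ZMod p) * ((16 * (c ^ 2 + 1))⁻¹) ^ k) =
      (quadraticChar (ZMod p) (2 * (c ^ 2 + 1)) : ZMod p) := by
  obtain ⟨n, hn⟩ := hp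
  have hp2 := (Fact.out : p.Prime).two_le
  have hchar : ringChar (ZMod p) ≠ 2 := by rw [ZMod.ringChar_zmod_n]; omega
  have h2 : (2 : ZMod p) ≠ 0 := Ring.two_ne_zero hchar
  rw [quadraticChar_eq_pow_of_char_ne_two' hchar, ZMod.card, show p / 2 = n by omega]
  set A := ∑ k ∈ Finset.range (p / 4 + 1),
        ((4 * k).choose (2 * k) : ZMod p) * (c ^ 2 * (16 * (c ^ 2 + 1))⁻¹) ^ k with hA
  set B := ∑ k ∈ Finset.range (p / 4 + 1),
        ((4 * k).choose (2 * k) : ZMod p) * ((16 * (c ^ 2 + 1))⁻¹) ^ k with hB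
  set d := c ^ 2 + 1 with hdd
  -- By Fermat `(2d)^n` is its own inverse, so the symbol may be moved to the other side.
  have hinv : ((2 * d) ^ n) ^ 2 = 1 := by
    rw [← pow_mul, show n * 2 = p - 1 by omega]
    exact ZMod.pow_card_sub_one_eq_one (mul_ne_zero h2 hd)
  suffices h : (2 * d) ^ n * (A * B) = 1 by
    linear_combination (2 * d) ^ n * h - (A * B) * hinv
  obtain ⟨K, _, _, ⟨φ⟩⟩ : ∃ (K : Type) (_ : Field K) (_ : IsAlgClosed K),
      Nonempty (ZMod p →+* K) :=
    ⟨AlgebraicClosure (ZMod p), inferInstance, inferInstance, ⟨algebraMap _ _⟩⟩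
  have : CharP K p := charP_of_injective_ringHom φ.injective p
  obtain ⟨s, hs⟩ := IsAlgClosed.exists_pow_nat_eq (φ d) two_pos
  have hφd : φ d = φ c ^ 2 + 1 := by simp [hdd]
  have hs0 : s ≠ 0 := by
    rintro rfl
    exact hd ((map_eq_zero φ).1 (by rw [← hs]; simp))
  have hc0 : φ c ≠ 0 := (map_ne_zero φ).2 hc
  have h2K : (2 : K) ≠ 0 := by rw [← map_ofNat φ 2]; exact (map_ne_zero φ).2 h2
  have h16 : (16 : K) ≠ 0 := by
    rw [show (16 : K) = 2 ^ 4 by norm_num]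
    exact pow_ne_zero 4 h2K
  have main := four_pow_sum_eq p hn.symm (hs.trans hφd) (by rw [← map_pow, ZMod.pow_card]) hc0
  have hA' : 2 * φ A = (1 + φ c / s) ^ n + (1 - φ c / s) ^ n := by
    rw [← sum_choose_four_mul_eq p hn.symm h16, hA, map_sum]
    congr 1
    refine Finset.sum_congr rfl fun k _ => ?_
    simp only [map_mul, map_pow, map_inv₀, map_natCast, ← hs, map_ofNat]
    congr 2
    field_simp
  have hB' : 2 * φ B = (1 + 1 / s) ^ n + (1 - 1 / s) ^ n := by
    rw [← sum_choose_four_mul_eq p hn.symm h16, hB, map_sum]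
    congr 1
    refine Finset.sum_congr rfl fun k _ => ?_
    simp only [map_mul, map_pow, map_inv₀, map_natCast, ← hs, map_ofNat]
    congr 2
    field_simp
  have clear (a : K) : s ^ n * ((1 + a / s) ^ n + (1 - a / s) ^ n) =
      (s + a) ^ n + (s - a) ^ n := by
    rw [mul_add, ← mul_pow, ← mul_pow, mul_add, mul_sub, mul_div_cancel₀ _ hs0, mul_one]
  rw [← clear, ← clear, ← hA', ← hB'] at main
  apply φ.injective
  have h4 : (4 : K) ≠ 0 := by
    rw [show (4 : K) = 2 ^ 2 by norm_num]
    exact pow_ne_zero 2 h2K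
  apply mul_left_cancel₀ h4
  -- The two factors `s^n` in `main` combine to `(s^2)^n`, the image of `d^n`.
  simp only [map_mul, map_pow, map_one, ← hs, map_ofNat, mul_pow]
  rw [mul_one]
  linear_combination main

/-- `x` is a `p`-integral rational whose residue modulo `p` is `a`. -/
def HasResidue (p : ℕ) [Fact p.Prime] (x : ℚ) (a : ZMod p) : Prop :=
  (x.den : ZMod p) ≠ 0 ∧ (x : ZMod p) = a

theorem hasResidue_of_mem {x : ℚ} (hx : x ∈ RatPIntegers p) : HasResidue p x (x : ZMod p) :=
  ⟨fun h => hx ((ZMod.natCast_eq_zero_iff _ _).1 h), rfl⟩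

namespace HasResidue

variable {x y : ℚ} {a b : ZMod p}

theorem intCast (m : ℤ) : HasResidue p (m : ℚ) (m : ZMod p) := by
  simp [HasResidue]

theorem natCast (m : ℕ) : HasResidue p (m : ℚ) (m : ZMod p) := by
  simp [HasResidue]

theorem add (hx : HasResidue p x a) (hy : HasResidue p y b) : HasResidue p (x + y) (a + b) := by
  refine ⟨fun h => mul_ne_zero hx.1 hy.1 ?_, ?_⟩
  · rw [← Nat.cast_mul]
    rw [ZMod.natCast_eq_zero_iff] at h ⊢
    exact h.trans (Rat.add_den_dvd x y)
  · rw [Rat.cast_add_of_ne_zero hx.1 hy.1, hx.2, hy.2]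

theorem mul (hx : HasResidue p x a) (hy : HasResidue p y b) : HasResidue p (x * y) (a * b) := by
  refine ⟨fun h => mul_ne_zero hx.1 hy.1 ?_, ?_⟩
  · rw [← Nat.cast_mul]
    rw [ZMod.natCast_eq_zero_iff] at h ⊢
    exact h.trans (Rat.mul_den_dvd x y)
  · rw [Rat.cast_mul_of_ne_zero hx.1 hy.1, hx.2, hy.2]

theorem pow (hx : HasResidue p x a) (k : ℕ) : HasResidue p (x ^ k) (a ^ k) := by
  induction k with
  | zero => simpa using natCast (p := p) 1
  | succ k ih => simpa only [pow_succ] using ih.mul hx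

theorem sum {ι : Type*} (s : Finset ι) {f : ι → ℚ} {g : ι → ZMod p}
    (h : ∀ i ∈ s, HasResidue p (f i) (g i)) : HasResidue p (∑ i ∈ s, f i) (∑ i ∈ s, g i) := by
  classical
  induction s using Finset.induction_on with
  | empty => simpa using natCast (p := p) 0
  | insert i s hi ih =>
    rw [Finset.sum_insert hi, Finset.sum_insert hi]
    exact (h i (Finset.mem_insert_self i s)).add
      (ih fun j hj => h j (Finset.mem_insert_of_mem hj))

theorem inv (hx : HasResidue p x a) (ha : a ≠ 0) : HasResidue p x⁻¹ a⁻¹ := by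
  have hnum : (x.num : ZMod p) ≠ 0 := by
    intro h
    apply ha
    rw [← hx.2, Rat.cast_def, h, zero_div]
  have hx0 : x ≠ 0 := by
    rintro rfl
    simp at hnum
  refine ⟨?_, by rw [Rat.cast_inv_of_ne_zero hnum, hx.2]⟩
  rw [Rat.den_inv_of_ne_zero hx0]
  intro h
  rw [ZMod.natCast_eq_zero_iff, ← Int.natCast_dvd] at h
  exact hnum ((ZMod.intCast_zmod_eq_zero_iff_dvd _ _).2 h)

theorem ratCongr_zero (hx : HasResidue p x 0) : RatCongr p x 0 := by
  have hp0 : (p : ℚ) ≠ 0 := Nat.cast_ne_zero.2 (Fact.out : p.Prime).ne_zero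
  have hnum : (x.num : ZMod p) = 0 := by
    have := hx.2
    rw [Rat.cast_def, div_eq_zero_iff] at this
    exact this.resolve_right hx.1
  obtain ⟨m, hm⟩ := (ZMod.intCast_zmod_eq_zero_iff_dvd _ _).1 hnum
  -- The fraction need not be in lowest terms; its reduced denominator divides `x.den`, which
  -- suffices.
  refine ⟨Rat.divInt m x.den, fun h => hx.1 ?_, ?_⟩
  · rw [ZMod.natCast_eq_zero_iff]
    exact h.trans (Int.natCast_dvd_natCast.1 (Rat.den_dvd m x.den))
  · rw [Rat.divInt_eq_div, sub_zero]
    conv_lhs => rw [← Rat.num_div_den x, hm]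
    push_cast
    ring

theorem ratCongr (hx : HasResidue p x a) (hy : HasResidue p y a) : RatCongr p x y := by
  have h := hx.add ((intCast (-1)).mul hy)
  have h0 : HasResidue p (x - y) 0 := by
    convert h using 1
    · push_cast; ring
    · push_cast; ring
  simpa [RatCongr] using h0.ratCongr_zero

theorem ratLegendreSym_eq (hx : HasResidue p x a) :
    ratLegendreSym p x = quadraticChar (ZMod p) a := by
  rw [ratLegendreSym, ← hx.2, Rat.cast_def, div_eq_mul_inv]

end HasResidue

end PrimeField

theorem corollary2p1 (p : ℕ) [Fact p.Prime] (hp : Odd p) (c : ℚ) (hc : c ∈ RatPIntegers p)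
    (hc0 : ¬ RatCongr p (c * (c ^ 2 + 1)) 0) :
    RatCongr p
      ((∑ k ∈ Finset.range (p / 4 + 1),
          ((4 * k).choose (2 * k) : ℚ) * (c ^ 2 / (16 * (c ^ 2 + 1))) ^ k) *
        (∑ k ∈ Finset.range (p / 4 + 1),
          ((4 * k).choose (2 * k) : ℚ) * (1 / (16 * (c ^ 2 + 1)) ^ k)))
      (ratLegendreSym p (2 * (c ^ 2 + 1)) : ℚ) := by
  have hp' : p ≠ 2 := by rintro rfl; exact absurd hp (by decide)
  have h2 : (2 : ZMod p) ≠ 0 := Ring.two_ne_zero (by rwa [ZMod.ringChar_zmod_n])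
  have rc := hasResidue_of_mem hc
  set a : ZMod p := (c : ZMod p)
  have rd : HasResidue p (c ^ 2 + 1) (a ^ 2 + 1) := by
    simpa using (rc.pow 2).add (HasResidue.natCast 1)
  have hne : a * (a ^ 2 + 1) ≠ 0 := fun h => hc0 (HasResidue.ratCongr_zero (h ▸ rc.mul rd))
  have ha := left_ne_zero_of_mul hne
  have hd := right_ne_zero_of_mul hne
  have h16 : (16 : ZMod p) ≠ 0 := by
    rw [show (16 : ZMod p) = 2 ^ 4 by norm_num]
    exact pow_ne_zero 4 h2
  have ru : HasResidue p (16 * (c ^ 2 + 1))⁻¹ (16 * (a ^ 2 + 1))⁻¹ := by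
    refine HasResidue.inv ?_ (mul_ne_zero h16 hd)
    simpa using (HasResidue.natCast 16).mul rd
  have r2d : HasResidue p (2 * (c ^ 2 + 1)) (2 * (a ^ 2 + 1)) := by
    simpa using (HasResidue.natCast 2).mul rd
  rw [r2d.ratLegendreSym_eq]
  refine HasResidue.ratCongr ?_ (HasResidue.intCast _)
  rw [← zmod_sum_mul_sum_eq hp ha hd]
  simp only [div_eq_mul_inv, one_mul, ← inv_pow]
  exact (HasResidue.sum _ fun k _ => (HasResidue.natCast _).mul (((rc.pow 2).mul ru).pow k)).mul
    (HasResidue.sum _ fun k _ => (HasResidue.natCast _).mul (ru.pow k))
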